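/- We work over $\mathbb{C}$. By an irreducible curve we mean an integral scheme of dimension one that is proper (equivalently, projective) over $\mathbb{C}$; it may be singular unless it is said to be smooth. The degree of a dominant morphism $X\to Y$ of irreducible curves is the degree $[\mathbb{C}(X):\mathbb{C}(Y)]$ of the extension of function fields. Let $D$ be a smooth irreducible projective curve with a faithful action of a finite group $G$ by automorphisms over $\mathbb{C}$. Let $\alpha,\beta\in G$ have orders $o(\alpha)=d\ge 2$ and $o(\beta)=e\ge 2$, let $B=D/\langle\beta\rangle$ and $C=D/\langle\alpha\rangle$, and let $p:D\to B$ and $q:D\to C$ be the quotient morphisms, which have degrees $e$ and $d$ respectively. We say that the diagram $B\xleftarrow{\,p\,}D\xrightarrow{\,q\,}C$ completes if there are an irreducible curve $H$, a morphism $u:B\to H$ of degree $d$ and a morphism $v:C\to H$ of degree $e$ such that $u\circ p=v\circ q$. Then: 1. if $|\langle\alpha,\beta\rangle|=e\cdot d$, the diagram completes; 2. if $|\langle\alpha,\beta\rangle|>e\cdot d$, the diagram does not complete. -/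

import Mathlib

open CategoryTheory AlgebraicGeometry

/-- `Spec ℂ`. -/
noncomputable abbrev SpecC : Scheme.{0} := Spec (CommRingCat.of ℂ)

/-- An irreducible complex curve: an integral scheme of dimension one, proper over `ℂ`.
(In dimension one, proper over a field is the same as projective.) It may be singular. -/
structure IsComplexCurve (X : Over SpecC) : Prop where
  integral : IsIntegral X.left
  proper : IsProper X.hom
  dim_eq_one : topologicalKrullDim X.left = 1

/-- The morphism `f : X ⟶ Y` has degree `n`, written `(n:1)` on an arrow: `X` and `Y` are integral,
`f` is dominant, and the function field of `X` is an extension of degree `n` of the function field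
of `Y`. The extension is the stalk map of `f` at the generic point of `X`; its source is
the function field of `Y`, as a dominant `f` sends the generic point to the generic point. -/
def HasDegree {X Y : Scheme.{0}} (f : X ⟶ Y) (n : ℕ) : Prop :=
  ∃ (_ : IsIntegral X) (_ : IsIntegral Y) (_ : IsDominant f),
    letI : Algebra (Y.presheaf.stalk (f (genericPoint X))) (X.presheaf.stalk (genericPoint X)) :=
      (f.stalkMap (genericPoint X)).hom.toAlgebra
    Module.Finite (Y.presheaf.stalk (f (genericPoint X))) (X.presheaf.stalk (genericPoint X)) ∧
      Module.finrank (Y.presheaf.stalk (f (genericPoint X)))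
        (X.presheaf.stalk (genericPoint X)) = n

/-- `π : X ⟶ Y` is the quotient of `X` by the group `Γ` of automorphisms over `ℂ`, that is,
`Y = X / Γ`: `π` is `Γ`-invariant, `Y` carries the quotient topology, the fibres of `π` are
the orbits of `Γ`, and the structure sheaf of `Y` is the sheaf of `Γ`-invariants of `π_* 𝒪_X`. -/
structure IsQuotientByGroup {X Y : Over SpecC} (Γ : Subgroup (Aut X)) (π : X ⟶ Y) : Prop where
  invariant : ∀ γ ∈ Γ, γ.hom ≫ π = π
  isQuotientMap : Topology.IsQuotientMap π.left
  exists_of_eq : ∀ x y : X.left, π.left x = π.left y → ∃ γ ∈ Γ, γ.hom.left x = y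
  app_injective : ∀ U : Y.left.Opens, Function.Injective (π.left.app U).hom
  /-- A section `s` over `V = π⁻¹ U` that is invariant comes from `U`. Here `appLE V V h` is
  the pullback of sections along `γ`, and `h` always holds, as `V` is `Γ`-stable. -/
  mem_range_app : ∀ (U : Y.left.Opens) (s : Γ(X.left, π.left ⁻¹ᵁ U)),
    (∀ γ ∈ Γ, ∀ h : π.left ⁻¹ᵁ U ≤ γ.hom.left ⁻¹ᵁ (π.left ⁻¹ᵁ U),
      (γ.hom.left.appLE (π.left ⁻¹ᵁ U) (π.left ⁻¹ᵁ U) h).hom s = s) →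
    s ∈ Set.range (π.left.app U).hom

/-- The diagram `B ⟵ D ⟶ C`, given by `p : D ⟶ B` of degree `e` and `q : D ⟶ C` of degree `d`,
completes: there are a curve `H` and morphisms `u : B ⟶ H` of degree `d` and `v : C ⟶ H` of
degree `e` that make the square commute. -/
def DiagramCompletes {D B C : Over SpecC} (p : D ⟶ B) (q : D ⟶ C) (d e : ℕ) : Prop :=
  ∃ (H : Over SpecC) (u : B ⟶ H) (v : C ⟶ H),
    IsComplexCurve H ∧ HasDegree u.left d ∧ HasDegree v.left e ∧ p ≫ u = q ≫ v

/-! Everything is read off from function fields. Let Γ be the image of ⟨α, β⟩ in Aut D. By Artin's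
theorem ℂ(D) has degree |Γ| over its field L of Γ-invariants (`finiteOfDegree_invariantSubfield`),
and ℂ(B), ℂ(C) are the invariants of ⟨β⟩ and ⟨α⟩
(`IsQuotientByGroup.mem_range_functionFieldMap_iff`).

If the diagram completes, the composite D ⟶ H is invariant under α and β, so ℂ(H) embeds in L. Hence
|Γ| divides [ℂ(D) : ℂ(H)] = d * e, which excludes |Γ| > e * d (`DiagramCompletes.card_sup_le`).

If |Γ| = e * d, the curve H has to have function field L. Since L is finitely generated over ℂ, it
has a proper model, possibly singular, as a closure in projective space (`exists_proper_model`). The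
local rings of the smooth curve D are valuation rings (`valuationRing_stalk_of_smooth`), and this
passes to B and C (`IsQuotientByGroup.valuationRing_stalk`). So by the valuative criterion the
inclusions of L in ℂ(B) and ℂ(C) come from morphisms B ⟶ H and C ⟶ H
(`exists_extension_of_isProper`). Their degrees follow from the tower law, and the square commutes
because it does so at the generic point and H is separated. -/

/-! ### Function fields and dominant morphisms -/

theorem isGenericPoint_map_of_isDominant {X Y : Scheme.{0}} [IsIntegral X] [IsIntegral Y]
    (f : X ⟶ Y) [IsDominant f] : f (genericPoint X) = genericPoint Y := by
  apply ((genericPoint_spec Y).eq _).symm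
  have h := (genericPoint_spec X).image f.continuous
  rwa [Set.image_univ, f.denseRange.closure_range] at h

/-- The map of function fields induced by a dominant morphism. -/
noncomputable def functionFieldMap {X Y : Scheme.{0}} [IsIntegral X] [IsIntegral Y]
    (f : X ⟶ Y) [IsDominant f] : Y.functionField ⟶ X.functionField :=
  Y.presheaf.stalkSpecializes (specializes_of_eq (isGenericPoint_map_of_isDominant f)) ≫
    f.stalkMap (genericPoint X)

/-- The inclusion of the generic point. -/
noncomputable abbrev fromSpecFunctionField (X : Scheme.{0}) [IrreducibleSpace X] :
    Spec X.functionField ⟶ X := X.fromSpecStalk (genericPoint X)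

instance (X : Scheme.{0}) [IsIntegral X] : IsDominant (fromSpecFunctionField X) := by
  refine ⟨?_⟩
  rw [DenseRange, Scheme.range_fromSpecStalk, dense_iff_closure_eq]
  exact Set.eq_univ_of_univ_subset
    ((genericPoint_closure (α := X)).symm.subset.trans
      (closure_mono (Set.singleton_subset_iff.mpr (specializes_refl _))))

theorem specMap_functionFieldMap {X Y : Scheme.{0}} [IsIntegral X] [IsIntegral Y]
    (f : X ⟶ Y) [IsDominant f] :
    Spec.map (functionFieldMap f) ≫ fromSpecFunctionField Y = fromSpecFunctionField X ≫ f := by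
  rw [functionFieldMap, Spec.map_comp, Category.assoc,
    Scheme.SpecMap_stalkSpecializes_fromSpecStalk, Scheme.SpecMap_stalkMap_fromSpecStalk]

theorem specMap_functionFieldMap_assoc {X Y Z : Scheme.{0}} [IsIntegral X] [IsIntegral Y]
    (f : X ⟶ Y) [IsDominant f] (g : Y ⟶ Z) :
    Spec.map (functionFieldMap f) ≫ fromSpecFunctionField Y ≫ g =
      fromSpecFunctionField X ≫ f ≫ g := by
  rw [← Category.assoc, specMap_functionFieldMap, Category.assoc]

/-- `fromSpecFunctionField Y` is a monomorphism, so identities between maps of function fields can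
be checked on morphisms into the scheme. Functoriality then needs no transport of stalks along
equalities of points. -/
theorem functionFieldMap_eq_iff {X Y : Scheme.{0}} [IsIntegral X] [IsIntegral Y]
    (f : X ⟶ Y) [IsDominant f] (φ : Y.functionField ⟶ X.functionField) :
    functionFieldMap f = φ ↔
      Spec.map φ ≫ fromSpecFunctionField Y = fromSpecFunctionField X ≫ f := by
  rw [← specMap_functionFieldMap, cancel_mono, Spec.map_inj, eq_comm]

theorem functionFieldMap_id (X : Scheme.{0}) [IsIntegral X] :
    functionFieldMap (𝟙 X) = 𝟙 _ := by
  rw [functionFieldMap_eq_iff]; simp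

theorem functionFieldMap_comp {X Y Z : Scheme.{0}} [IsIntegral X] [IsIntegral Y] [IsIntegral Z]
    (f : X ⟶ Y) (g : Y ⟶ Z) [IsDominant f] [IsDominant g] :
    functionFieldMap (f ≫ g) = functionFieldMap g ≫ functionFieldMap f := by
  rw [functionFieldMap_eq_iff, Spec.map_comp, Category.assoc, specMap_functionFieldMap,
    specMap_functionFieldMap_assoc]

theorem functionFieldMap_germ {X Y : Scheme.{0}} [IsIntegral X] [IsIntegral Y]
    (f : X ⟶ Y) [IsDominant f] (U : Y.Opens) (V : X.Opens) (h : V ≤ f ⁻¹ᵁ U)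
    (hU : genericPoint Y ∈ U) (hV : genericPoint X ∈ V) (s : Γ(Y, U)) :
    (functionFieldMap f).hom (Y.presheaf.germ U _ hU s) =
      X.presheaf.germ V _ hV ((f.appLE U V h).hom s) := by
  have h1 : Y.presheaf.germ U _ hU ≫ functionFieldMap f =
      f.appLE U V h ≫ X.presheaf.germ V _ hV := by
    rw [functionFieldMap, ← Category.assoc, TopCat.Presheaf.germ_stalkSpecializes,
      Scheme.Hom.germ_stalkMap, Scheme.Hom.appLE, Category.assoc, TopCat.Presheaf.germ_res]
  exact congr($h1 s)

/-- Morphisms over a base from an integral scheme to a separated one agree as soon as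
they agree at the generic point. -/
theorem eq_of_fromSpecFunctionField_comp_eq {X Y Z : Scheme.{0}} [IsIntegral X] (f g : X ⟶ Y)
    (s : Y ⟶ Z) [IsSeparated s] (hs : f ≫ s = g ≫ s)
    (h : fromSpecFunctionField X ≫ f = fromSpecFunctionField X ≫ g) : f = g :=
  ext_of_isDominant_of_isSeparated s hs (fromSpecFunctionField X) h

/-! ### Degrees of field extensions -/

/-- The extension of rings `φ` is finite of rank `n`. -/
def RingHom.FiniteOfDegree {F E : Type*} [CommRing F] [CommRing E] (φ : F →+* E) (n : ℕ) : Prop :=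
  letI := φ.toAlgebra
  Module.Finite F E ∧ Module.finrank F E = n

theorem RingHom.finiteOfDegree_comp_ringEquiv_iff {F F' E : Type*} [CommRing F] [CommRing F']
    [CommRing E] (φ : F' →+* E) (e : F ≃+* F') (n : ℕ) :
    (φ.comp e.toRingHom).FiniteOfDegree n ↔ φ.FiniteOfDegree n := by
  let a := (φ.comp e.toRingHom).toAlgebra
  let b := φ.toAlgebra
  have hc : RingHom.comp (algebraMap F' E) ↑e =
      RingHom.comp ↑(RingEquiv.refl E) (algebraMap F E) := rfl
  have h1 := Algebra.finrank_eq_of_equiv_equiv e (.refl E) hc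
  have h2 : Module.Finite F E ↔ Module.Finite F' E := by
    constructor
    · intro _
      exact Module.Finite.of_equiv_equiv e (.refl E) hc
    · intro _
      refine Module.Finite.of_equiv_equiv e.symm (.refl E) ?_
      ext x
      have := congr($hc (e.symm x))
      simpa using this.symm
  change Module.Finite F E ∧ Module.finrank F E = n ↔ Module.Finite F' E ∧ Module.finrank F' E = n
  rw [h2, h1]

theorem hasDegree_iff {X Y : Scheme.{0}} [IsIntegral X] [IsIntegral Y] (f : X ⟶ Y)
    [IsDominant f] (n : ℕ) :
    HasDegree f n ↔ (functionFieldMap f).hom.FiniteOfDegree n := by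
  have e := RingHom.finiteOfDegree_comp_ringEquiv_iff (f.stalkMap (genericPoint X)).hom
    (Y.presheaf.stalkCongr
      (.of_eq (isGenericPoint_map_of_isDominant f).symm)).commRingCatIsoToRingEquiv n
  constructor
  · rintro ⟨_, _, _, h⟩
    exact e.mpr h
  · intro h
    exact ⟨inferInstance, inferInstance, inferInstance, e.mp h⟩

theorem RingHom.FiniteOfDegree.comp {F E K : Type*} [Field F] [Field E] [Field K] {φ : F →+* E}
    {ψ : E →+* K} {m n : ℕ} (hφ : φ.FiniteOfDegree m) (hψ : ψ.FiniteOfDegree n) :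
    (ψ.comp φ).FiniteOfDegree (m * n) := by
  algebraize [φ, ψ, ψ.comp φ]
  obtain ⟨_, h1⟩ : Module.Finite F E ∧ Module.finrank F E = m := hφ
  obtain ⟨_, h2⟩ : Module.Finite E K ∧ Module.finrank E K = n := hψ
  exact ⟨.trans E K, by rw [← h1, ← h2, Module.finrank_mul_finrank]⟩

theorem RingHom.FiniteOfDegree.of_comp {F E K : Type*} [Field F] [Field E] [Field K] {φ : F →+* E}
    {ψ : E →+* K} {m n : ℕ} (h : (ψ.comp φ).FiniteOfDegree (m * n)) (hψ : ψ.FiniteOfDegree n)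
    (hn : n ≠ 0) : φ.FiniteOfDegree m := by
  algebraize [φ, ψ, ψ.comp φ]
  obtain ⟨_, h1⟩ : Module.Finite F K ∧ Module.finrank F K = m * n := h
  obtain ⟨_, h2⟩ : Module.Finite E K ∧ Module.finrank E K = n := hψ
  refine ⟨Module.Finite.of_injective (IsScalarTower.toAlgHom F E K).toLinearMap
    (RingHom.injective _), ?_⟩
  rw [← Module.finrank_mul_finrank F E K, h2] at h1
  exact Nat.eq_of_mul_eq_mul_right (Nat.pos_of_ne_zero hn) h1

theorem RingHom.FiniteOfDegree.of_range_eq {F K : Type*} [Field F] [Field K] {φ : F →+* K}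
    (S : Subfield K) {n : ℕ} (hS : ∀ x, x ∈ S ↔ x ∈ Set.range φ)
    (h : S.subtype.FiniteOfDegree n) : φ.FiniteOfDegree n := by
  let e : F ≃+* S := RingEquiv.ofBijective (φ.codRestrict S fun x ↦ (hS _).mpr ⟨x, rfl⟩)
    ⟨RingHom.injective _, fun y ↦ by
      obtain ⟨x, hx⟩ := (hS _).mp y.2
      exact ⟨x, Subtype.ext hx⟩⟩
  exact (RingHom.finiteOfDegree_comp_ringEquiv_iff S.subtype e n).mpr h

/-! ### Rational functions and where they are regular -/

/-- A rational function which is regular at every point of `V` is a section over `V`. -/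
theorem exists_section_of_forall_mem_range_stalk {X : Scheme.{0}} [IsIntegral X]
    (f : X.functionField) (V : X.Opens) (hη : genericPoint X ∈ V)
    (hV : ∀ x ∈ V, f ∈ Set.range (algebraMap (X.presheaf.stalk x) X.functionField)) :
    ∃ s : Γ(X, V), X.presheaf.germ V _ hη s = f := by
  have key (x : V) : ∃ (U : X.Opens) (_ : U ≤ V) (_ : x.1 ∈ U) (hU : genericPoint X ∈ U)
      (s : Γ(X, U)), X.presheaf.germ U _ hU s = f := by
    obtain ⟨a, ha⟩ := hV x.1 x.2
    obtain ⟨U, hUV, hx, s, hs⟩ := X.presheaf.exists_le_germ_eq a x.2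
    have hU : genericPoint X ∈ U := (genericPoint_specializes _).mem_open U.2 hx
    refine ⟨U, hUV, hx, hU, s, ?_⟩
    have : Nonempty U := ⟨⟨_, hx⟩⟩
    rw [← ha, ← hs, Scheme.algebraMap_germ_eq_germToFunctionField]
  choose U hUV hxU hU s hs using key
  obtain ⟨t, ht, -⟩ := X.sheaf.existsUnique_gluing' U V (fun i ↦ homOfLE (hUV i))
    (fun x hx ↦ TopologicalSpace.Opens.mem_iSup.mpr ⟨⟨x, hx⟩, hxU _⟩) s (by
      intro x y
      apply germ_injective_of_isIntegral (X := X) (U := U x ⊓ U y) (genericPoint X)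
        ⟨hU x, hU y⟩
      erw [TopCat.Presheaf.germ_res_apply, TopCat.Presheaf.germ_res_apply]
      rw [hs, hs])
  refine ⟨t, ?_⟩
  have h0 := ht ⟨_, hη⟩
  have := hs ⟨_, hη⟩
  rw [← h0] at this
  erw [TopCat.Presheaf.germ_res_apply] at this
  exact this

theorem functionFieldMap_algebraMap_stalk {X Y : Scheme.{0}} [IsIntegral X] [IsIntegral Y]
    (f : X ⟶ Y) [IsDominant f] (x : X) (a : Y.presheaf.stalk (f x)) :
    (functionFieldMap f).hom (algebraMap (Y.presheaf.stalk (f x)) Y.functionField a) =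
      algebraMap (X.presheaf.stalk x) X.functionField (f.stalkMap x a) := by
  have h : Y.presheaf.stalkSpecializes (genericPoint_specializes (f x)) ≫ functionFieldMap f =
      f.stalkMap x ≫ X.presheaf.stalkSpecializes (genericPoint_specializes x) := by
    rw [functionFieldMap, TopCat.Presheaf.stalkSpecializes_comp_assoc,
      Scheme.Hom.stalkSpecializes_stalkMap]
  exact congr($h a)

/-- The open set where a rational function is regular. -/
def regularLocus {X : Scheme.{0}} [IsIntegral X] (f : X.functionField) : X.Opens where
  carrier := {x | f ∈ Set.range (algebraMap (X.presheaf.stalk x) X.functionField)}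
  is_open' := by
    rw [isOpen_iff_forall_mem_open]
    rintro x ⟨a, ha⟩
    obtain ⟨U, hx, s, hs⟩ := X.presheaf.exists_germ_eq a
    refine ⟨U, fun y hy ↦ ⟨X.presheaf.germ U y hy s, ?_⟩, U.2, hx⟩
    have : Nonempty U := ⟨⟨_, hx⟩⟩
    rw [← ha, ← hs, Scheme.algebraMap_germ_eq_germToFunctionField,
      Scheme.algebraMap_germ_eq_germToFunctionField]

theorem mem_regularLocus {X : Scheme.{0}} [IsIntegral X] {f : X.functionField} {x : X} :
    x ∈ regularLocus f ↔ f ∈ Set.range (algebraMap (X.presheaf.stalk x) X.functionField) :=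
  Iff.rfl

theorem mem_regularLocus_functionFieldMap {X Y : Scheme.{0}} [IsIntegral X] [IsIntegral Y]
    (g : X ⟶ Y) [IsDominant g] {f : Y.functionField} {x : X} (h : g x ∈ regularLocus f) :
    x ∈ regularLocus ((functionFieldMap g).hom f) := by
  obtain ⟨a, ha⟩ := h
  exact ⟨g.stalkMap x a, by rw [← functionFieldMap_algebraMap_stalk, ha]⟩

theorem genericPoint_mem_regularLocus {X : Scheme.{0}} [IsIntegral X] (f : X.functionField) :
    genericPoint X ∈ regularLocus f := by
  refine ⟨f, ?_⟩
  change X.presheaf.stalkSpecializes _ f = f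
  rw [TopCat.Presheaf.stalkSpecializes_refl]
  rfl

/-! ### Function field and local rings of a quotient -/

instance Over.isIso_left_aut {S : Scheme.{0}} {X : Over S} (γ : Aut X) : IsIso γ.hom.left :=
  ((Over.forget S).mapIso γ).isIso_hom

namespace IsQuotientByGroup

variable {X Y : Over SpecC} {Γ : Subgroup (Aut X)} {π : X ⟶ Y}

theorem surjective_left (h : IsQuotientByGroup Γ π) : Surjective π.left :=
  ⟨h.isQuotientMap.surjective⟩

theorem isIntegral_left [IsIntegral X.left] (h : IsQuotientByGroup Γ π) : IsIntegral Y.left where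
  nonempty := (inferInstance : Nonempty X.left).map π.left
  component_integral U hU := by
    obtain ⟨⟨y, hy⟩⟩ := hU
    obtain ⟨x, rfl⟩ := h.isQuotientMap.surjective y
    have : Nonempty (π.left ⁻¹ᵁ U) := ⟨⟨x, hy⟩⟩
    exact (h.app_injective U).isDomain (π.left.app U).hom

/-- The regular locus of an invariant rational function is Γ-stable, hence the preimage of an open
set of the quotient. Over it the function is an invariant section, so it descends. At the generic
point this computes the function field of the quotient; at other points it controls the local rings.
-/
theorem exists_stalk_of_invariant [IsIntegral X.left] [IsIntegral Y.left] [IsDominant π.left]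
    (h : IsQuotientByGroup Γ π) (f : X.left.functionField)
    (hf : ∀ γ ∈ Γ, (functionFieldMap γ.hom.left).hom f = f) (x : X.left)
    (hx : x ∈ regularLocus f) :
    ∃ b : Y.left.presheaf.stalk (π.left x), (functionFieldMap π.left).hom
      (algebraMap (Y.left.presheaf.stalk (π.left x)) Y.left.functionField b) = f := by
  have hsat : π.left ⁻¹' (π.left '' (regularLocus f : Set X.left)) = regularLocus f := by
    refine (Set.subset_preimage_image _ _).antisymm' ?_
    rintro z ⟨w, hw, hwz⟩
    obtain ⟨γ, hγ, rfl⟩ := h.exists_of_eq z w hwz.symm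
    have := mem_regularLocus_functionFieldMap γ.hom.left hw
    rwa [hf γ hγ] at this
  let U : Y.left.Opens := ⟨π.left '' (regularLocus f : Set X.left), by
    rw [← h.isQuotientMap.isOpen_preimage, hsat]
    exact (regularLocus f).2⟩
  have hU : π.left ⁻¹ᵁ U = regularLocus f := TopologicalSpace.Opens.ext hsat
  have hη : genericPoint X.left ∈ π.left ⁻¹ᵁ U := hU ▸ genericPoint_mem_regularLocus f
  obtain ⟨s, hs⟩ := exists_section_of_forall_mem_range_stalk f (π.left ⁻¹ᵁ U) hη
    fun z hz ↦ by rwa [hU] at hz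
  obtain ⟨t, ht⟩ := h.mem_range_app U s fun γ hγ hle ↦ by
    apply germ_injective_of_isIntegral X.left _ hη
    rw [hs, ← functionFieldMap_germ γ.hom.left _ _ hle hη hη, hs, hf γ hγ]
  have hxU : π.left x ∈ U := ⟨x, hx, rfl⟩
  refine ⟨Y.left.presheaf.germ U _ hxU t, ?_⟩
  have : Nonempty (π.left ⁻¹ᵁ U) := ⟨⟨x, hxU⟩⟩
  rw [functionFieldMap_algebraMap_stalk, Scheme.Hom.germ_stalkMap_apply]
  have hxV : x ∈ π.left ⁻¹ᵁ U := hxU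
  exact (Scheme.algebraMap_germ_eq_germToFunctionField X.left hxV _).trans
    ((congrArg _ ht).trans hs)

theorem functionFieldMap_invariant [IsIntegral X.left] [IsIntegral Y.left] [IsDominant π.left]
    (h : IsQuotientByGroup Γ π) (γ : Aut X) (hγ : γ ∈ Γ) (z : Y.left.functionField) :
    (functionFieldMap γ.hom.left).hom ((functionFieldMap π.left).hom z) =
      (functionFieldMap π.left).hom z := by
  have h1 : γ.hom.left ≫ π.left = π.left := by
    rw [← Over.comp_left, h.invariant γ hγ]
  have h2 := functionFieldMap_comp γ.hom.left π.left
  simp only [h1] at h2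
  exact congr($h2 z).symm

theorem mem_range_functionFieldMap_iff [IsIntegral X.left] [IsIntegral Y.left] [IsDominant π.left]
    (h : IsQuotientByGroup Γ π) (f : X.left.functionField) :
    f ∈ Set.range (functionFieldMap π.left).hom ↔
      ∀ γ ∈ Γ, (functionFieldMap γ.hom.left).hom f = f := by
  constructor
  · rintro ⟨z, rfl⟩ γ hγ
    exact h.functionFieldMap_invariant γ hγ z
  · intro hf
    obtain ⟨b, hb⟩ := h.exists_stalk_of_invariant f hf _ (genericPoint_mem_regularLocus f)
    exact ⟨_, hb⟩

/-- The pullback of a rational function z on Y is invariant, so if it is regular at x then z is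
regular at the image of x. Applied to z and z⁻¹, this carries the valuation property down. -/
theorem valuationRing_stalk [IsIntegral X.left] [IsIntegral Y.left] [IsDominant π.left]
    (h : IsQuotientByGroup Γ π) (hX : ∀ x : X.left, ValuationRing (X.left.presheaf.stalk x))
    (y : Y.left) : ValuationRing (Y.left.presheaf.stalk y) := by
  obtain ⟨x, rfl⟩ := h.isQuotientMap.surjective y
  have key (z : Y.left.functionField)
      (hz : (functionFieldMap π.left).hom z ∈
        Set.range (algebraMap (X.left.presheaf.stalk x) X.left.functionField)) :
      z ∈ Set.range (algebraMap (Y.left.presheaf.stalk (π.left x)) Y.left.functionField) := by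
    obtain ⟨b, hb⟩ := h.exists_stalk_of_invariant _
      (fun γ hγ ↦ h.functionFieldMap_invariant γ hγ z) x hz
    exact ⟨b, (functionFieldMap π.left).hom.injective hb⟩
  rw [ValuationRing.iff_isInteger_or_isInteger _ Y.left.functionField]
  intro z
  have := hX x
  rcases ValuationRing.isInteger_or_isInteger (X.left.presheaf.stalk x)
    ((functionFieldMap π.left).hom z) with hz | hz
  · exact .inl (key z hz)
  · rw [← map_inv₀] at hz
    exact .inr (key _ hz)

end IsQuotientByGroup

/-! ### Extending rational maps into proper schemes -/

theorem exists_lift_of_valuationRing {X S : Scheme.{0}} (f : X ⟶ S) [IsProper f]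
    (R K : CommRingCat.{0}) [IsDomain R] [ValuationRing R] (hK : IsField K) (φ : R ⟶ K)
    (hφ : letI := φ.hom.toAlgebra; IsFractionRing R K)
    (i₁ : Spec K ⟶ X) (i₂ : Spec R ⟶ S) (h : i₁ ≫ f = Spec.map φ ≫ i₂) :
    ∃ l : Spec R ⟶ X, Spec.map φ ≫ l = i₁ ∧ l ≫ f = i₂ := by
  have hcrit : ValuativeCriterion.Existence f := by
    have : UniversallyClosed f := inferInstance
    rw [UniversallyClosed.eq_valuativeCriterion] at this
    exact this.1
  let _ : Field K := hK.toField
  let _ : Algebra R K := φ.hom.toAlgebra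
  obtain ⟨⟨l⟩⟩ := hcrit
    { R := R, K := K, i₁ := i₁, i₂ := i₂, commSq := ⟨h⟩, isFractionRing := hφ }
  exact ⟨l.l, l.fac_left, l.fac_right⟩

theorem Scheme.Opens.specMap_stalkSpecializes_fromSpecStalkOfMem {X : Scheme.{0}} (U : X.Opens)
    {x y : X} (h : x ⤳ y) (hx : x ∈ U) (hy : y ∈ U) :
    Spec.map (X.presheaf.stalkSpecializes h) ≫ U.fromSpecStalkOfMem y hy =
      U.fromSpecStalkOfMem x hx := by
  rw [← cancel_mono U.ι, Category.assoc, Scheme.Opens.fromSpecStalkOfMem_ι,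
    Scheme.Opens.fromSpecStalkOfMem_ι, Scheme.SpecMap_stalkSpecializes_fromSpecStalk]

/-- A morphism from the generic point of an integral scheme whose local rings are valuation rings
to a proper scheme extends to the whole scheme. -/
theorem exists_extension_of_isProper {X H S : Scheme.{0}} [IsIntegral X] (sX : X ⟶ S)
    (sH : H ⟶ S) [IsProper sH] [S.IsSeparated]
    (hX : ∀ x : X, ValuationRing (X.presheaf.stalk x)) (g : Spec X.functionField ⟶ H)
    (hg : g ≫ sH = fromSpecFunctionField X ≫ sX) :
    ∃ u : X ⟶ H, u ≫ sH = sX ∧ fromSpecFunctionField X ≫ u = g := by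
  have : H.IsSeparated := ⟨by
    rw [← Limits.terminal.comp_from sH]; infer_instance⟩
  let r : X ⤏ H := .ofFunctionField sX sH g hg
  have hr : r.fromFunctionField = g := Scheme.RationalMap.fromFunctionField_ofFunctionField ..
  have hdom : r.domain = ⊤ := by
    -- At each x the valuative criterion gives a lift from the spectrum of the local ring. It
    -- spreads out to a neighbourhood of x, and the resulting partial map represents `r` because
    -- both agree at the generic point.
    refine eq_top_iff.mpr fun x _ ↦ ?_
    have := hX x
    have hspec : Spec.map (X.presheaf.stalkSpecializes (genericPoint_specializes x)) ≫
        X.fromSpecStalk x = fromSpecFunctionField X :=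
      Scheme.SpecMap_stalkSpecializes_fromSpecStalk _
    have : IsDomain (X.presheaf.stalk x) := inferInstance
    obtain ⟨l, hl', hl⟩ := exists_lift_of_valuationRing sH (X.presheaf.stalk x) X.functionField
      (Field.toIsField X.functionField) (X.presheaf.stalkSpecializes (genericPoint_specializes x))
      (inferInstanceAs (IsFractionRing (X.presheaf.stalk x) X.functionField)) g
      (X.fromSpecStalk x ≫ sX) (by rw [hg, ← hspec, Category.assoc])
    let m : X.PartialMap H := .ofFromSpecStalk sX sH l hl
    have hxm : x ∈ m.domain := Scheme.PartialMap.mem_domain_ofFromSpecStalk ..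
    refine Scheme.RationalMap.mem_domain.mpr ⟨m, hxm, ?_⟩
    apply Scheme.RationalMap.eq_of_fromFunctionField_eq
    rw [hr, Scheme.RationalMap.fromFunctionField_toRationalMap, ← hl']
    have h1 : m.domain.fromSpecStalkOfMem x hxm ≫ m.hom = l :=
      Scheme.PartialMap.fromSpecStalkOfMem_ofFromSpecStalk ..
    rw [← h1, ← Category.assoc, Scheme.Opens.specMap_stalkSpecializes_fromSpecStalkOfMem _ _
      ((genericPoint_specializes x).mem_open m.domain.2 hxm)]
    rfl
  let m := r.toPartialMap
  have hm : m.domain = ⊤ := hdom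
  have hm2 : m.fromFunctionField = g := by
    rw [← hr, ← r.toRationalMap_toPartialMap]; rfl
  have hη : genericPoint X ∈ m.domain := hm ▸ trivial
  have : IsIso m.domain.ι := by
    rw [hm]; exact inferInstanceAs (IsIso X.topIso.hom)
  have hu : fromSpecFunctionField X ≫ inv m.domain.ι ≫ m.hom = g := by
    rw [← hm2, fromSpecFunctionField, ← Scheme.Opens.fromSpecStalkOfMem_ι m.domain _ hη,
      Category.assoc,
      IsIso.hom_inv_id_assoc]
    rfl
  refine ⟨inv m.domain.ι ≫ m.hom, ?_, hu⟩
  have : IsSeparated (Limits.terminal.from S) := inferInstance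
  refine eq_of_fromSpecFunctionField_comp_eq _ _ (Limits.terminal.from S)
    (Limits.terminal.hom_ext _ _) ?_
  rw [← hg, ← hu]; simp only [Category.assoc]

/-! ### Proper models of finitely generated fields -/

instance isSchemeTheoreticallyDominant_toImage {X Y : Scheme.{0}} (f : X ⟶ Y) [QuasiCompact f] :
    IsSchemeTheoreticallyDominant f.toImage := by
  refine ⟨Scheme.IdealSheafData.ext_of_iSup_eq_top
    (fun U : Y.affineOpens ↦ ⟨f.imageι ⁻¹ᵁ U.1, U.2.preimage _⟩)
    (TopologicalSpace.IsOpenCover.comap (iSup_affineOpens_eq_top _) _) fun U ↦ ?_⟩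
  simp only [Scheme.Hom.ker_apply, Scheme.IdealSheafData.ideal_bot, Pi.bot_apply]
  rw [← RingHom.injective_iff_ker_eq_bot]
  exact f.toImage_app_injective U

theorem isIntegral_image {X Y : Scheme.{0}} [IsIntegral X] (f : X ⟶ Y) [QuasiCompact f] :
    IsIntegral f.image := by
  have hd : IsDominant f.toImage := inferInstance
  have : IsReduced f.image := IsSchemeTheoreticallyDominant.isReduced f.toImage
  have : IrreducibleSpace f.image := by
    rw [irreducibleSpace_def]
    have h := ((IrreducibleSpace.isIrreducible_univ X).image _
          f.toImage.continuous.continuousOn).closure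
    rwa [Set.image_univ, f.toImage.denseRange.closure_range] at h
  exact isIntegral_of_irreducibleSpace_of_isReduced _

/-- The spectrum of a field is a single point; dominance forces its image to be the generic point,
so the morphism factors through the stalk there. -/
theorem exists_functionField_lift {H : Scheme.{0}} [IsIntegral H] (L : Type) [Field L]
    (g : Spec (.of L) ⟶ H) [IsDominant g] :
    ∃ ι : H.functionField ⟶ .of L, Spec.map ι ≫ fromSpecFunctionField H = g := by
  have h : genericPoint H = g (IsLocalRing.closedPoint L) := by
    apply (genericPoint_spec H).eq
    have h1 : Set.range g = {g (IsLocalRing.closedPoint L)} := by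
      refine Set.Subset.antisymm ?_ (Set.singleton_subset_iff.mpr ⟨_, rfl⟩)
      rintro _ ⟨x, rfl⟩
      exact congrArg g (Subsingleton.elim (α := PrimeSpectrum L) _ _)
    exact (congrArg closure h1).symm.trans g.denseRange.closure_range
  refine ⟨H.presheaf.stalkSpecializes (specializes_of_eq h.symm) ≫
    Scheme.stalkClosedPointTo g, ?_⟩
  rw [Spec.map_comp, Category.assoc, Scheme.SpecMap_stalkSpecializes_fromSpecStalk]
  exact Scheme.Spec_stalkClosedPointTo_fromSpecStalk g

/-- If a dominant map from the generic point `Spec L` lifts to an affine chart of a scheme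
containing `H`, the functions on the chart restrict to elements of the function field of `H`. -/
theorem exists_fac_functionField {H P : Scheme.{0}} [IsIntegral H] (i : H ⟶ P) (L : Type) [Field L]
    (ι : H.functionField ⟶ .of L) (R : CommRingCat.{0}) (j : Spec R ⟶ P) [IsOpenImmersion j]
    (ψ : R ⟶ .of L) (h : Spec.map ι ≫ fromSpecFunctionField H ≫ i = Spec.map ψ ≫ j) :
    ∃ χ : R ⟶ H.functionField, χ ≫ ι = ψ := by
  have hr : Set.range (fromSpecFunctionField H ≫ i) ⊆ Set.range j := by
    rintro _ ⟨x, rfl⟩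
    have hx : x = Spec.map ι (IsLocalRing.closedPoint L) :=
      Subsingleton.elim (α := PrimeSpectrum H.functionField) _ _
    rw [hx]
    exact ⟨Spec.map ψ (IsLocalRing.closedPoint L),
      congr($h.symm (IsLocalRing.closedPoint L : PrimeSpectrum L))⟩
  let l := IsOpenImmersion.lift j (fromSpecFunctionField H ≫ i) hr
  refine ⟨Spec.preimage l, ?_⟩
  apply Spec.map_injective
  rw [Spec.map_comp, Spec.map_preimage, ← cancel_mono j, Category.assoc,
    IsOpenImmersion.lift_fac, h]

theorem HomogeneousLocalization.Away.exists_lift {A L : Type*} [CommRing A] [Field L]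
    [Algebra ℂ A] (𝒜 : ℕ → Submodule ℂ A) [GradedAlgebra 𝒜] {f : A} (hf : f ∈ 𝒜 1) (e : A →+* L)
    (he : e f = 1) : ∃ ψ : HomogeneousLocalization.Away 𝒜 f →+* L,
      ∀ (n : ℕ) (x : A) (hx : x ∈ 𝒜 (n • 1)),
        ψ (HomogeneousLocalization.Away.mk 𝒜 hf n x hx) = e x := by
  let ev : Localization.Away f →+* L :=
    IsLocalization.Away.lift (g := e) f (by rw [he]; exact isUnit_one)
  refine ⟨ev.comp (algebraMap (HomogeneousLocalization.Away 𝒜 f) (Localization.Away f)),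
    fun n x hx ↦ ?_⟩
  change ev (HomogeneousLocalization.Away.mk 𝒜 hf n x hx).val = _
  rw [HomogeneousLocalization.Away.val_mk, Localization.mk_eq_mk']
  refine (IsLocalization.lift_mk'_spec _ _ _ _).mpr ?_
  simp [he]

section
attribute [local instance] MvPolynomial.gradedAlgebra

open MvPolynomial in
/-- A finitely generated field extension of `ℂ` is the function field of an integral scheme that
is proper over `ℂ`: the closure in a projective space of the point given by generators. -/
theorem exists_proper_model (L : Type) [Field L] [Algebra ℂ L]
    (hL : (⊤ : IntermediateField ℂ L).FG) :
    ∃ (H : Over SpecC) (_ : IsIntegral H.left) (g : Spec (.of L) ⟶ H.left)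
      (ι : H.left.functionField ⟶ .of L),
      IsProper H.hom ∧ g ≫ H.hom = Spec.map (CommRingCat.ofHom (algebraMap ℂ L)) ∧
      Spec.map ι ≫ fromSpecFunctionField H.left = g ∧ Function.Bijective ι.hom := by
  obtain ⟨S, hS⟩ := hL
  -- Projective coordinates of the point: the generators in `S`, together with an extra coordinate
  -- `none` equal to 1, whose nonvanishing defines the affine chart.
  let a : Option S → L := fun o ↦ o.elim 1 (fun s ↦ s.1)
  have hX (o : Option S) : X o ∈ homogeneousSubmodule (Option S) ℂ 1 := isHomogeneous_X _ _
  let e : MvPolynomial (Option S) ℂ →ₐ[ℂ] L := aeval a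
  obtain ⟨ψ, hψ⟩ := HomogeneousLocalization.Away.exists_lift
    (homogeneousSubmodule (Option S) ℂ) (hX none) e.toRingHom (by simp [e, a])
  let j : Spec (.of (HomogeneousLocalization.Away (homogeneousSubmodule (Option S) ℂ) (X none))) ⟶
      Proj (homogeneousSubmodule (Option S) ℂ) :=
    Proj.awayι (homogeneousSubmodule (Option S) ℂ) (X none) (hX none) one_pos
  let f : Spec (.of L) ⟶ Proj (homogeneousSubmodule (Option S) ℂ) :=
    Spec.map (CommRingCat.ofHom ψ) ≫ j
  let z : ℂ →+* (homogeneousSubmodule (Option S) ℂ 0) :=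
    algebraMap ℂ ((homogeneousSubmodule (Option S) ℂ 0))
  -- `Proj` is proper over the spectrum of the degree-zero part. As that part consists of constants,
  -- the map on to `Spec ℂ` is a closed immersion, and properness over ℂ follows.
  have hz : Function.Surjective z := by
    rintro ⟨x, hx⟩
    have hx' : x.totalDegree = 0 := by
      rw [MvPolynomial.totalDegree_zero_iff_isHomogeneous]; exact hx
    exact ⟨_, Subtype.ext (totalDegree_eq_zero_iff_eq_C.mp hx').symm⟩
  have : IsClosedImmersion (Spec.map (CommRingCat.ofHom z)) :=
    IsClosedImmersion.spec_of_surjective _ hz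
  have : Algebra.FiniteType (homogeneousSubmodule (Option S) ℂ 0) (MvPolynomial (Option S) ℂ) := by
    rw [← RingHom.finiteType_algebraMap]
    refine RingHom.FiniteType.of_comp_finiteType (f := z) ?_
    exact RingHom.finiteType_algebraMap.mpr
      (inferInstanceAs (Algebra.FiniteType ℂ (MvPolynomial (Option S) ℂ)))
  let H : Over SpecC := Over.mk (f.imageι ≫
    Proj.toSpecZero (homogeneousSubmodule (Option S) ℂ) ≫ Spec.map (CommRingCat.ofHom z))
  have hH : IsIntegral H.left := isIntegral_image f
  have hp : IsProper H.hom := inferInstanceAs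
    (IsProper (f.imageι ≫ Proj.toSpecZero (homogeneousSubmodule (Option S) ℂ) ≫
      Spec.map (CommRingCat.ofHom z)))
  let i : H.left ⟶ Proj (homogeneousSubmodule (Option S) ℂ) := f.imageι
  let g : Spec (.of L) ⟶ H.left := f.toImage
  have hgi : g ≫ i = f := f.toImage_imageι
  have : IsDominant g := inferInstanceAs (IsDominant f.toImage)
  obtain ⟨ι, hι⟩ := exists_functionField_lift L g
  refine ⟨H, hH, g, ι, hp, ?_, hι, ι.hom.injective, ?_⟩
  · change f.toImage ≫ f.imageι ≫ _ = _
    rw [Scheme.Hom.toImage_imageι_assoc]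
    simp only [f, j, Category.assoc, Proj.awayι_toSpecZero_assoc]
    rw [← Spec.map_comp, ← Spec.map_comp]
    congr 1
    ext c
    refine (hψ 0 (C c) (isHomogeneous_C _ _)).trans ?_
    simp [e]
  -- Surjectivity of `ι`: the coordinate functions of the chart are rational functions on `H` and
  -- take the generators as values, so the range contains ℂ and `S`.
  · obtain ⟨χ, hχ⟩ := exists_fac_functionField i L ι _ j (CommRingCat.ofHom ψ) (by
      rw [← Category.assoc, hι, hgi])
    have hr (n : ℕ) (x) (hx : x ∈ homogeneousSubmodule (Option S) ℂ (n • 1)) :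
        e x ∈ ι.hom.fieldRange :=
      ⟨χ (.mk _ (hX none) n x hx), congr($hχ _).trans (hψ n x hx)⟩
    have h0 (c : ℂ) : algebraMap ℂ L c ∈ ι.hom.fieldRange := by
      simpa [e] using hr 0 (C c) (isHomogeneous_C _ _)
    let F : IntermediateField ℂ L := ι.hom.fieldRange.toIntermediateField h0
    have hF : F = ⊤ := by
      rw [eq_top_iff, ← hS, IntermediateField.adjoin_le_iff]
      intro s hs
      have := hr 1 (X (some ⟨s, hs⟩)) (hX _)
      rwa [aeval_X] at this
    intro y
    have hy : y ∈ F := hF ▸ trivial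
    exact hy

end

/-! ### Dimension, differentials and valuation rings -/

/-- Dimension does not increase along a map of orders along which chains can be lifted upwards. -/
theorem Order.krullDim_le_of_exists_lift {α β : Type*} [Preorder α] [Preorder β] (f : β → α)
    (hf : Monotone f) (hs : Function.Surjective f)
    (hlift : ∀ (b : β) (a : α), f b ≤ a → ∃ b', b ≤ b' ∧ f b' = a) :
    Order.krullDim α ≤ Order.krullDim β := by
  have key (n : ℕ) : ∀ p : LTSeries α, p.length = n →
      ∃ q : LTSeries β, q.length = n ∧ f q.last = p.last := by
    induction n with
    | zero =>
      intro p hp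
      obtain ⟨b, hb⟩ := hs p.last
      exact ⟨RelSeries.singleton _ b, rfl, hb⟩
    | succ n ih =>
      intro p hp
      have hne : p.length ≠ 0 := by omega
      obtain ⟨q, hq, hql⟩ := ih p.eraseLast (by simp [hp])
      have hlt : p.eraseLast.last < p.last := p.eraseLast_last_rel_last hne
      obtain ⟨b, hb, hba⟩ := hlift q.last p.last (hql ▸ hlt.le)
      have hlt' : q.last < b := lt_of_le_not_ge hb fun h ↦
        (hql ▸ hba ▸ hlt : f q.last < f b).not_ge (hf h)
      exact ⟨q.snoc b hlt', by simp [hq], by simp [hba]⟩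
  refine iSup_le fun p ↦ ?_
  obtain ⟨q, hq, -⟩ := key _ p rfl
  rw [← hq]
  exact LTSeries.length_le_krullDim q

/-- Lying over starts a chain of primes and going up continues it. -/
theorem ringKrullDim_le_of_isIntegral (A B : Type*) [CommRing A] [CommRing B] [Algebra A B]
    [Algebra.IsIntegral A B] (h : Function.Injective (algebraMap A B)) :
    ringKrullDim A ≤ ringKrullDim B := by
  have hlift (I : Ideal B) (P : Ideal A) [P.IsPrime] (hP : I.comap (algebraMap A B) ≤ P) :
      ∃ Q ≥ I, Q.IsPrime ∧ Q.comap (algebraMap A B) = P :=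
    Ideal.exists_ideal_over_prime_of_isIntegral P I hP
  refine Order.krullDim_le_of_exists_lift (PrimeSpectrum.comap (algebraMap A B))
    (fun x y hxy ↦ Ideal.comap_mono hxy) (fun P ↦ ?_) (fun b P hP ↦ ?_)
  · obtain ⟨Q, -, hQ, hQP⟩ := hlift ⊥ P.asIdeal (by
      rw [← RingHom.ker_eq_comap_bot, (RingHom.injective_iff_ker_eq_bot _).mp h]; exact bot_le)
    exact ⟨⟨Q, hQ⟩, PrimeSpectrum.ext hQP⟩
  · obtain ⟨Q, hbQ, hQ, hQP⟩ := hlift b.asIdeal P.asIdeal hP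
    exact ⟨⟨Q, hQ⟩, hbQ, PrimeSpectrum.ext hQP⟩

/-- By Noether normalization A is finite over a polynomial ring P in s variables. In characteristic
zero K is formally étale over P, so its differentials have rank s, the dimension of P, which is at
most that of A. -/
theorem finrank_kaehlerDifferential_le_ringKrullDim (k A K : Type) [Field k] [CharZero k]
    [CommRing A] [Algebra k A] [Algebra.FiniteType k A] [Field K] [Algebra A K] [IsDomain A]
    [IsFractionRing A K] [Algebra k K] [IsScalarTower k A K] :
    (Module.finrank K Ω[K⁄k] : WithBot ℕ∞) ≤ ringKrullDim A := by
  obtain ⟨s, g, hg, hgf⟩ := exists_finite_inj_algHom_of_fg k A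
  let P := MvPolynomial (Fin s) k
  algebraize [g.toRingHom]
  have : Algebra.IsIntegral P A := ⟨hgf.to_isIntegral⟩
  let _ : Algebra P K := ((algebraMap A K).comp g.toRingHom).toAlgebra
  have : IsScalarTower P A K := .of_algebraMap_eq' rfl
  have : IsScalarTower k P K := .of_algebraMap_eq' (by
    ext x
    change _ = algebraMap A K (g (algebraMap k P x))
    rw [g.commutes, ← IsScalarTower.algebraMap_apply])
  have : FaithfulSMul P K := (faithfulSMul_iff_algebraMap_injective _ _).mpr
    ((IsFractionRing.injective A K).comp hg)
  let F := FractionRing P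
  let _ : Algebra F K := FractionRing.liftAlgebra P K
  have : IsScalarTower P F K := inferInstance
  have : Algebra.IsAlgebraic A K :=
    (IsFractionRing.comap_isAlgebraic_iff (A := A) (K := K) (C := K)).mpr inferInstance
  have : Algebra.IsAlgebraic P K := .trans P A K
  have : Algebra.IsAlgebraic F K := (IsFractionRing.comap_isAlgebraic_iff (A := P)).mp this
  have : CharZero F := charZero_of_injective_algebraMap (algebraMap k F).injective
  have : Algebra.FormallyEtale F K := .of_isSeparable _ _
  have : Algebra.FormallyEtale P F := .of_isLocalization (nonZeroDivisors P)
  have : Algebra.FormallyEtale P K := .comp P F K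
  have h1 := (KaehlerDifferential.tensorKaehlerEquivOfFormallyEtale k P K).finrank_eq
  rw [Module.finrank_baseChange,
    Module.finrank_eq_card_basis (KaehlerDifferential.mvPolynomialBasis k (Fin s)),
    Fintype.card_fin] at h1
  rw [← h1]
  refine le_trans ?_ (ringKrullDim_le_of_isIntegral P A hg)
  rw [MvPolynomial.ringKrullDim_of_isNoetherianRing]
  simp

open IsLocalRing TensorProduct in
-- Since k is perfect, the residue field is formally smooth over k, so the conormal map from the
-- cotangent space of R to the differentials of R tensored with the residue field is split
-- injective. The target has the dimension of Ω[K⁄k], at most 1, and a Noetherian local domain with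
-- cotangent space of dimension at most 1 is a valuation ring.
theorem valuationRing_of_formallySmooth (k R K : Type) [Field k] [PerfectField k] [CommRing R]
    [IsDomain R] [IsLocalRing R] [Algebra k R] [Algebra.EssFiniteType k R]
    [Algebra.FormallySmooth k R] [Field K] [Algebra R K] [IsFractionRing R K] [Algebra k K]
    [IsScalarTower k R K] (h : Module.finrank K Ω[K⁄k] ≤ 1) : ValuationRing R := by
  have : IsNoetherianRing R := Algebra.EssFiniteType.isNoetherianRing k R
  have : Algebra.FormallyEtale R K := .of_isLocalization (nonZeroDivisors R)
  have h1 := (KaehlerDifferential.tensorKaehlerEquivOfFormallyEtale k R K).finrank_eq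
  have : Module.Free R Ω[R⁄k] := Module.free_of_flat_of_isLocalRing
  rw [Module.finrank_baseChange] at h1
  have hsurj : Function.Surjective (algebraMap R (ResidueField R)) := residue_surjective
  have hker : RingHom.ker (algebraMap R (ResidueField R)) = maximalIdeal R := ker_residue
  have : Algebra.EssFiniteType k (ResidueField R) :=
    inferInstanceAs (Algebra.EssFiniteType k (R ⧸ maximalIdeal R))
  have : Algebra.FormallySmooth k (ResidueField R) := inferInstance
  obtain ⟨l, hl⟩ := (Algebra.FormallySmooth.iff_split_injection (R := k) (P := R) hsurj).mp this
  have hinj : Function.Injective (KaehlerDifferential.kerCotangentToTensor k R (ResidueField R)) :=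
    fun x y hxy ↦ (congr($hl x)).symm.trans ((congrArg l hxy).trans congr($hl y))
  obtain ⟨f, hf⟩ : ∃ f : CotangentSpace R →ₗ[R] ResidueField R ⊗[R] Ω[R⁄k],
      Function.Injective f := by
    unfold CotangentSpace
    rw [← hker]
    exact ⟨_, hinj⟩
  refine ((tfae_of_isNoetherianRing_of_isLocalRing_of_isDomain R).out 5 1).mp ?_
  have h2 := LinearMap.finrank_le_finrank_of_injective
    (f := LinearMap.extendScalarsOfSurjective hsurj f) hf
  rw [Module.finrank_baseChange, h1] at h2
  exact h2.trans h

/-! ### Function fields over ℂ and local rings of smooth curves -/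

/-- Subextensions with algebraic complement of finitely generated field extensions are finitely
generated. -/
theorem IntermediateField.fg_top_of_isAlgebraic (F L K : Type*) [Field F] [Field L] [Field K]
    [Algebra F L] [Algebra F K] [Algebra L K] [IsScalarTower F L K] [Algebra.EssFiniteType F K]
    [Algebra.IsAlgebraic L K] : (⊤ : IntermediateField F L).FG := by
  -- A transcendence basis of L stays algebraically independent in K, so it is finite. Then K is
  -- finite over the field it generates, and so is the subspace L.
  obtain ⟨s, hs⟩ := exists_isTranscendenceBasis F L
  have hs' : s.Finite := finite_of_algebraicIndependent
    (x := fun i : s ↦ algebraMap L K i.1) (K := F)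
    (hs.1.map' (f := IsScalarTower.toAlgHom F L K) (algebraMap L K).injective)
  have halg : Algebra.IsAlgebraic (adjoin F s) L := by
    have := hs.isAlgebraic_field
    rwa [Subtype.range_coe] at this
  have : Algebra.IsAlgebraic (adjoin F s) K := .trans _ L K
  have : Algebra.EssFiniteType (adjoin F s) K := .of_comp F _ K
  have : Module.Finite (adjoin F s) K := Algebra.finite_of_essFiniteType_of_isAlgebraic
  have : Module.Finite (adjoin F s) L := .of_injective
    (IsScalarTower.toAlgHom (adjoin F s) L K).toLinearMap (algebraMap L K).injective
  have : Algebra.EssFiniteType F (adjoin F s) :=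
    essFiniteType_iff.mpr (fg_adjoin_of_finite hs')
  exact fg_top_iff.mpr (.comp F (adjoin F s) L)

/-- The algebra structure on the function field of an integral complex scheme. -/
noncomputable abbrev algebraFunctionField {X : Scheme.{0}} [IsIntegral X] (f : X ⟶ SpecC) :
    Algebra ℂ X.functionField :=
  (Spec.preimage (fromSpecFunctionField X ≫ f)).hom.toAlgebra

theorem specMap_algebraMap_functionField {X : Scheme.{0}} [IsIntegral X] (f : X ⟶ SpecC) :
    letI := algebraFunctionField f
    Spec.map (CommRingCat.ofHom (algebraMap ℂ X.functionField)) = fromSpecFunctionField X ≫ f :=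
  Spec.map_preimage _

theorem specMap_germ_fromSpec {X : Scheme.{0}} [IsIntegral X] {U : X.Opens} [Nonempty U]
    (hU : IsAffineOpen U) :
    Spec.map (X.germToFunctionField U) ≫ hU.fromSpec = fromSpecFunctionField X :=
  hU.fromSpecStalk_eq_fromSpecStalk (x := genericPoint X)
    (((genericPoint_spec X).mem_open_set_iff U.2).mpr (by simpa using ‹Nonempty U›))

theorem essFiniteType_functionField {X : Scheme.{0}} [IsIntegral X] (f : X ⟶ SpecC)
    [LocallyOfFiniteType f] :
    letI := algebraFunctionField f
    Algebra.EssFiniteType ℂ X.functionField := by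
  let _ := algebraFunctionField f
  obtain ⟨U, hU, hx, -⟩ := exists_isAffineOpen_mem_and_subset
    (x := genericPoint X) (U := ⊤) trivial
  have : Nonempty U := ⟨⟨_, hx⟩⟩
  let φ : CommRingCat.of ℂ ⟶ Γ(X, U) := Spec.preimage (hU.fromSpec ≫ f)
  have hφ : Spec.map φ = hU.fromSpec ≫ f := Spec.map_preimage _
  let _ : Algebra ℂ Γ(X, U) := φ.hom.toAlgebra
  have : Algebra.FiniteType ℂ Γ(X, U) := by
    have h : LocallyOfFiniteType (Spec.map φ) := by rw [hφ]; infer_instance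
    exact (HasRingHomProperty.Spec_iff (P := @LocallyOfFiniteType)).mp h
  have : IsScalarTower ℂ Γ(X, U) X.functionField := .of_algebraMap_eq' (by
    have : CommRingCat.ofHom (algebraMap ℂ X.functionField) = φ ≫ X.germToFunctionField U := by
      apply Spec.map_injective
      rw [specMap_algebraMap_functionField, Spec.map_comp, hφ, reassoc_of% specMap_germ_fromSpec hU]
    exact congr($(this).hom))
  have := functionField_isFractionRing_of_isAffineOpen X U hU
  have : Algebra.EssFiniteType Γ(X, U) X.functionField :=
    .of_isLocalization _ (nonZeroDivisors Γ(X, U))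
  exact .comp ℂ Γ(X, U) _

/-- The one place where smoothness of the curve enters. An affine chart bounds the rank of the
differentials of the function field by 1, and each local ring is a localization of the smooth
algebra of that chart. -/
theorem valuationRing_stalk_of_smooth {X : Scheme.{0}} [IsIntegral X] (f : X ⟶ SpecC)
    [Smooth f] (hX : topologicalKrullDim X ≤ 1) (x : X) : ValuationRing (X.presheaf.stalk x) := by
  let _ := algebraFunctionField f
  obtain ⟨U, hU, hx, -⟩ := exists_isAffineOpen_mem_and_subset (x := x) (U := ⊤) trivial
  have : Nonempty U := ⟨⟨_, hx⟩⟩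
  let φ : CommRingCat.of ℂ ⟶ Γ(X, U) := Spec.preimage (hU.fromSpec ≫ f)
  have hφ : Spec.map φ = hU.fromSpec ≫ f := Spec.map_preimage _
  let _ : Algebra ℂ Γ(X, U) := φ.hom.toAlgebra
  have : Algebra.Smooth ℂ Γ(X, U) := by
    have h : Smooth (Spec.map φ) := by rw [hφ]; infer_instance
    exact (HasRingHomProperty.Spec_iff (P := @Smooth)).mp h
  have : IsScalarTower ℂ Γ(X, U) X.functionField := .of_algebraMap_eq' (by
    have : CommRingCat.ofHom (algebraMap ℂ X.functionField) = φ ≫ X.germToFunctionField U := by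
      apply Spec.map_injective
      rw [specMap_algebraMap_functionField, Spec.map_comp, hφ, reassoc_of% specMap_germ_fromSpec hU]
    exact congr($(this).hom))
  have := functionField_isFractionRing_of_isAffineOpen X U hU
  have hdim : ringKrullDim Γ(X, U) ≤ 1 := by
    rw [← PrimeSpectrum.topologicalKrullDim_eq_ringKrullDim]
    change topologicalKrullDim (Spec Γ(X, U)) ≤ 1
    rw [← IsHomeomorph.topologicalKrullDim_eq _ hU.isoSpec.hom.homeomorph.isHomeomorph]
    exact (topologicalKrullDim_subspace_le X U).trans hX
  let _ : Algebra Γ(X, U) (X.presheaf.stalk x) := (X.presheaf.germ U x hx).hom.toAlgebra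
  let _ : Algebra ℂ (X.presheaf.stalk x) :=
    ((algebraMap Γ(X, U) (X.presheaf.stalk x)).comp (algebraMap ℂ Γ(X, U))).toAlgebra
  have : IsScalarTower ℂ Γ(X, U) (X.presheaf.stalk x) := .of_algebraMap_eq' rfl
  have : IsScalarTower Γ(X, U) (X.presheaf.stalk x) X.functionField := .of_algebraMap_eq
    fun a ↦ (Scheme.algebraMap_germ_eq_germToFunctionField ..).symm
  have : IsScalarTower ℂ (X.presheaf.stalk x) X.functionField := .of_algebraMap_eq fun a ↦ by
    rw [IsScalarTower.algebraMap_apply ℂ Γ(X, U) X.functionField,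
      IsScalarTower.algebraMap_apply Γ(X, U) (X.presheaf.stalk x) X.functionField]
    rfl
  have : IsLocalization.AtPrime (X.presheaf.stalk x) (hU.primeIdealOf ⟨x, hx⟩).asIdeal :=
    hU.isLocalization_stalk ⟨x, hx⟩
  have : Algebra.EssFiniteType Γ(X, U) (X.presheaf.stalk x) :=
    .of_isLocalization _ (hU.primeIdealOf ⟨x, hx⟩).asIdeal.primeCompl
  have : Algebra.FormallyEtale Γ(X, U) (X.presheaf.stalk x) :=
    .of_isLocalization (hU.primeIdealOf ⟨x, hx⟩).asIdeal.primeCompl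
  have : Algebra.EssFiniteType ℂ (X.presheaf.stalk x) := .comp ℂ Γ(X, U) _
  have : Algebra.FormallySmooth ℂ (X.presheaf.stalk x) := .comp ℂ Γ(X, U) _
  refine valuationRing_of_formallySmooth ℂ (X.presheaf.stalk x) X.functionField ?_
  exact_mod_cast (finrank_kaehlerDifferential_le_ringKrullDim ℂ Γ(X, U) X.functionField).trans hdim

/-! ### Dimension of the target of a proper morphism -/

theorem IsClosedMap.topologicalKrullDim_le {X Y : Type*} [TopologicalSpace X] [TopologicalSpace Y]
    [QuasiSober Y] {f : X → Y} (hf : IsClosedMap f) (hc : Continuous f)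
    (hs : Function.Surjective f) : topologicalKrullDim Y ≤ topologicalKrullDim X := by
  have key (x : X) (W : TopologicalSpace.IrreducibleCloseds Y) (hW : IsGenericPoint (f x) W) :
      TopologicalSpace.IrreducibleCloseds.map f hc
        ⟨closure {x}, isIrreducible_singleton.closure, isClosed_closure⟩ = W := by
    ext1
    change closure (f '' closure {x}) = _
    rw [(hf _ isClosed_closure).closure_eq, ← hW.def, ← hf.closure_image_eq_of_continuous hc,
      Set.image_singleton]
  -- A closed map lifts chains of irreducible closed sets from larger to smaller, the reverse of
  -- `Order.krullDim_le_of_exists_lift`; hence the dual orders.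
  unfold topologicalKrullDim
  rw [← Order.krullDim_orderDual,
    ← Order.krullDim_orderDual (α := TopologicalSpace.IrreducibleCloseds X)]
  refine Order.krullDim_le_of_exists_lift (fun Z ↦ OrderDual.toDual
    (TopologicalSpace.IrreducibleCloseds.map f hc (OrderDual.ofDual Z)))
    (fun _ _ h ↦ TopologicalSpace.IrreducibleCloseds.map_mono hc h) (fun W ↦ ?_) (fun Z W h ↦ ?_)
  · obtain ⟨w, hw⟩ := QuasiSober.sober (OrderDual.ofDual W).isIrreducible
      (OrderDual.ofDual W).isClosed
    obtain ⟨x, rfl⟩ := hs w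
    exact ⟨_, key x _ hw⟩
  · obtain ⟨w, hw⟩ := QuasiSober.sober (OrderDual.ofDual W).isIrreducible
      (OrderDual.ofDual W).isClosed
    obtain ⟨x, hx, rfl⟩ := (hf _ (OrderDual.ofDual Z).isClosed).closure_eq.le (h hw.mem)
    exact ⟨OrderDual.toDual ⟨closure {x}, isIrreducible_singleton.closure, isClosed_closure⟩,
      closure_minimal (Set.singleton_subset_iff.mpr hx) (OrderDual.ofDual Z).isClosed, key x _ hw⟩

/-- The spectrum of the local ring at x is the set of generizations of x, among them the generic
point; for a field it has only one point. -/
theorem eq_genericPoint_of_isField_stalk {X : Scheme.{0}} [IsIntegral X] {x : X}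
    (h : IsField (X.presheaf.stalk x)) : x = genericPoint X := by
  let _ := h.toField
  have hx : x ∈ Set.range (X.fromSpecStalk x) := by
    rw [Scheme.range_fromSpecStalk]; exact specializes_rfl
  have hη : genericPoint X ∈ Set.range (X.fromSpecStalk x) := by
    rw [Scheme.range_fromSpecStalk]; exact genericPoint_specializes x
  obtain ⟨a, ha⟩ := hx
  obtain ⟨b, hb⟩ := hη
  have : Subsingleton (PrimeSpectrum (X.presheaf.stalk x)) := inferInstance
  rw [← ha, ← hb, Subsingleton.elim (α := PrimeSpectrum (X.presheaf.stalk x)) a b]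

theorem RingHom.exists_comp_eq {A B C : Type*} [CommRing A] [CommRing B] [CommRing C]
    (ψ : A →+* B) (hψ : Function.Injective ψ) (φ : C →+* B) (h : ∀ c, φ c ∈ Set.range ψ) :
    ∃ l : C →+* A, ψ.comp l = φ := by
  let e := RingEquiv.ofBijective ψ.rangeRestrict
    ⟨fun a b h ↦ hψ (congrArg Subtype.val h), ψ.rangeRestrict_surjective⟩
  exact ⟨e.symm.toRingHom.comp (φ.codRestrict ψ.range h),
    RingHom.ext fun c ↦ congrArg Subtype.val (e.apply_symm_apply (φ.codRestrict ψ.range h c))⟩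

/-- Over the generic point every rational function of Y pulls back to one regular at x. So the
function field of X is integral over the local ring at x, which must then be a field. -/
theorem eq_genericPoint_of_isIntegral_functionFieldMap {X Y : Scheme.{0}} [IsIntegral X]
    [IsIntegral Y] (f : X ⟶ Y) [IsDominant f] (hf : (functionFieldMap f).hom.IsIntegral) {x : X}
    (hx : f x = genericPoint Y) : x = genericPoint X := by
  have hinj := IsFractionRing.injective (X.presheaf.stalk x) X.functionField
  obtain ⟨l, hl⟩ := (algebraMap (X.presheaf.stalk x) X.functionField).exists_comp_eq hinj
    (functionFieldMap f).hom fun c ↦ mem_regularLocus.mp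
      (mem_regularLocus_functionFieldMap f (hx ▸ genericPoint_mem_regularLocus c))
  have : Algebra.IsIntegral (X.presheaf.stalk x) X.functionField :=
    ⟨RingHom.IsIntegral.tower_top _ _ (hl ▸ hf)⟩
  exact eq_genericPoint_of_isField_stalk
    (isField_of_isIntegral_of_isField hinj (Field.toIsField X.functionField))

theorem topologicalKrullDim_eq_one_of_isProper {X Y : Scheme.{0}} [IsIntegral X] [IsIntegral Y]
    (f : X ⟶ Y) [IsDominant f] [IsProper f] (hf : (functionFieldMap f).hom.IsIntegral)
    (hX : topologicalKrullDim X = 1) : topologicalKrullDim Y = 1 := by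
  have hc : IsClosedMap f := f.isClosedMap
  have hs : Function.Surjective f := by
    rw [← Set.range_eq_univ, ← hc.isClosed_range.closure_eq]
    exact f.denseRange.closure_range
  refine le_antisymm (hX ▸ hc.topologicalKrullDim_le f.continuous hs) ?_
  -- A proper irreducible closed subset has a nongeneric generic point, whose image is again
  -- nongeneric and so gives a chain of length one in Y.
  obtain ⟨Z, W, hZW⟩ := Order.one_le_krullDim_iff.mp hX.ge
  obtain ⟨z, hz⟩ := QuasiSober.sober Z.isIrreducible Z.isClosed
  have hzη : f z ≠ genericPoint Y := fun h ↦ by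
    have := eq_genericPoint_of_isIntegral_functionFieldMap f hf h
    refine hZW.not_ge fun w _ ↦ ?_
    change w ∈ (Z : Set X)
    rw [← hz.def, this, (genericPoint_spec X).def]
    trivial
  refine Order.one_le_krullDim_iff.mpr
    ⟨⟨closure {f z}, isIrreducible_singleton.closure, isClosed_closure⟩,
      ⟨Set.univ, IrreducibleSpace.isIrreducible_univ Y, isClosed_univ⟩,
      lt_of_le_not_ge (Set.subset_univ _) fun h ↦ hzη ?_⟩
  exact IsGenericPoint.eq (Set.univ_subset_iff.mp h) (genericPoint_spec Y)

/-! ### The group action on the function field and its invariants -/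

theorem functionFieldMap_comp_eq_id {X Y : Scheme.{0}} [IsIntegral X] [IsIntegral Y] {f : X ⟶ Y}
    {g : Y ⟶ X} [IsDominant f] [IsDominant g] (h : f ≫ g = 𝟙 X) :
    functionFieldMap g ≫ functionFieldMap f = 𝟙 _ := by
  rw [← functionFieldMap_comp, functionFieldMap_eq_iff, h, Spec.map_id, Category.id_comp,
    Category.comp_id]

/-- The action of the automorphisms of `X` on its function field. -/
noncomputable def autFunctionField {S : Scheme.{0}} (X : Over S) [IsIntegral X.left] :
    Aut X →* RingAut X.left.functionField where
  -- Pullback reverses products, and the inverse turns it into a homomorphism.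
  toFun γ := RingEquiv.ofRingHom (functionFieldMap γ⁻¹.hom.left).hom
    (functionFieldMap γ.hom.left).hom
    (congrArg CommRingCat.Hom.hom (functionFieldMap_comp_eq_id
      (f := γ⁻¹.hom.left) (g := γ.hom.left) (congrArg (·.left) γ.inv_hom_id)))
    (congrArg CommRingCat.Hom.hom (functionFieldMap_comp_eq_id
      (f := γ.hom.left) (g := γ⁻¹.hom.left) (congrArg (·.left) γ.hom_inv_id)))
  map_one' := RingEquiv.ext fun f ↦ congr($(functionFieldMap_id X.left) f)
  map_mul' γ δ := RingEquiv.ext fun f ↦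
    congr($(functionFieldMap_comp γ⁻¹.hom.left δ⁻¹.hom.left) f)

theorem autFunctionField_inv_apply {S : Scheme.{0}} {X : Over S} [IsIntegral X.left] (γ : Aut X)
    (f : X.left.functionField) :
    autFunctionField X γ⁻¹ f = (functionFieldMap γ.hom.left).hom f := rfl

/-- By separatedness an automorphism that is trivial at the generic point is trivial. Artin's
theorem needs this faithfulness. -/
theorem autFunctionField_injective {S : Scheme.{0}} (X : Over S) [IsIntegral X.left]
    [IsSeparated X.hom] : Function.Injective (autFunctionField X) := by
  refine (injective_iff_map_eq_one _).mpr fun γ hγ ↦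
    inv_eq_one.mp (Iso.ext (Over.OverMorphism.ext ?_))
  have h : functionFieldMap γ⁻¹.hom.left = 𝟙 _ := by
    ext f
    exact congr($hγ f)
  refine eq_of_fromSpecFunctionField_comp_eq _ _ X.hom (by simp) ?_
  have h1 := ((functionFieldMap_eq_iff _ _).mp h).symm
  rw [Spec.map_id, Category.id_comp] at h1
  exact h1.trans (Category.comp_id _).symm

/-- The rational functions that are invariant under `Γ`. -/
noncomputable def invariantSubfield {S : Scheme.{0}} {X : Over S} [IsIntegral X.left]
    (Γ : Subgroup (Aut X)) : Subfield X.left.functionField :=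
  letI := MulSemiringAction.compHom X.left.functionField ((autFunctionField X).comp Γ.subtype)
  FixedPoints.subfield Γ X.left.functionField

theorem mem_invariantSubfield {S : Scheme.{0}} {X : Over S} [IsIntegral X.left]
    {Γ : Subgroup (Aut X)} {f : X.left.functionField} :
    f ∈ invariantSubfield Γ ↔ ∀ γ ∈ Γ, (functionFieldMap γ.hom.left).hom f = f :=
  ⟨fun h γ hγ ↦ h ⟨γ⁻¹, inv_mem hγ⟩, fun h γ ↦ by
    have := h γ⁻¹ (inv_mem γ.2)
    rwa [← autFunctionField_inv_apply, inv_inv] at this⟩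

theorem finiteOfDegree_invariantSubfield {S : Scheme.{0}} {X : Over S} [IsIntegral X.left]
    [IsSeparated X.hom] (Γ : Subgroup (Aut X)) [Finite Γ] :
    (invariantSubfield Γ).subtype.FiniteOfDegree (Nat.card Γ) := by
  let _ := MulSemiringAction.compHom X.left.functionField ((autFunctionField X).comp Γ.subtype)
  have : FaithfulSMul Γ X.left.functionField := ⟨fun h ↦ Subtype.ext
    (autFunctionField_injective X (RingEquiv.ext h))⟩
  have := Fintype.ofFinite Γ
  have h1 := FixedPoints.finrank_eq_card Γ X.left.functionField
  rw [← Nat.card_eq_fintype_card] at h1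
  exact ⟨inferInstanceAs
    (Module.Finite (FixedPoints.subfield Γ X.left.functionField) X.left.functionField), h1⟩

theorem comp_eq_of_mem_sup {𝒞 : Type*} [Category 𝒞] {X Y : 𝒞} (w : X ⟶ Y)
    {Γ₁ Γ₂ : Subgroup (Aut X)} (h₁ : ∀ γ ∈ Γ₁, γ.hom ≫ w = w) (h₂ : ∀ γ ∈ Γ₂, γ.hom ≫ w = w) :
    ∀ γ ∈ Γ₁ ⊔ Γ₂, γ.hom ≫ w = w := by
  let S : Subgroup (Aut X) :=
    { carrier := {γ | γ.hom ≫ w = w}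
      mul_mem' := fun {γ δ} (hγ : γ.hom ≫ w = w) (hδ : δ.hom ≫ w = w) ↦ by
        change (δ.hom ≫ γ.hom) ≫ w = w
        rw [Category.assoc, hγ, hδ]
      one_mem' := Category.id_comp w
      inv_mem' := fun {γ} (hγ : γ.hom ≫ w = w) ↦ (Iso.inv_comp_eq γ).mpr hγ.symm }
  exact fun γ hγ ↦ (sup_le (c := S) h₁ h₂) hγ

theorem functionFieldMap_mem_invariantSubfield {S : Scheme.{0}} {X Y : Over S}
    [IsIntegral X.left] [IsIntegral Y.left] {Γ : Subgroup (Aut X)} (w : X ⟶ Y)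
    [IsDominant w.left] (h : ∀ γ ∈ Γ, γ.hom ≫ w = w) (c : Y.left.functionField) :
    (functionFieldMap w.left).hom c ∈ invariantSubfield Γ := by
  refine mem_invariantSubfield.mpr fun γ hγ ↦ ?_
  have h1 : functionFieldMap (γ.hom.left ≫ w.left) = functionFieldMap w.left := by
    simp_rw [← Over.comp_left, h γ hγ]
  rw [functionFieldMap_comp] at h1
  exact congr($h1 c)

theorem IsQuotientByGroup.finiteOfDegree {X Y : Over SpecC} {Γ : Subgroup (Aut X)} [Finite Γ]
    {π : X ⟶ Y} [IsIntegral X.left] [IsIntegral Y.left] [IsDominant π.left] [IsSeparated X.hom]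
    (h : IsQuotientByGroup Γ π) : (functionFieldMap π.left).hom.FiniteOfDegree (Nat.card Γ) :=
  .of_range_eq _ (fun f ↦ mem_invariantSubfield.trans (h.mem_range_functionFieldMap_iff f).symm)
    (finiteOfDegree_invariantSubfield Γ)

theorem RingHom.FiniteOfDegree.dvd_of_comp {F E K : Type*} [Field F] [Field E] [Field K]
    {φ : F →+* E} {ψ : E →+* K} {m n : ℕ} (h : (ψ.comp φ).FiniteOfDegree m)
    (hψ : ψ.FiniteOfDegree n) : n ∣ m := by
  algebraize [φ, ψ, ψ.comp φ]
  obtain ⟨-, h1⟩ : Module.Finite F K ∧ Module.finrank F K = m := h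
  obtain ⟨-, h2⟩ : Module.Finite E K ∧ Module.finrank E K = n := hψ
  exact ⟨Module.finrank F E, by rw [← h1, ← h2, mul_comm, Module.finrank_mul_finrank]⟩

theorem RingHom.FiniteOfDegree.isIntegral {F K : Type*} [Field F] [Field K]
    {φ : F →+* K} {n : ℕ} (h : φ.FiniteOfDegree n) : φ.IsIntegral := by
  algebraize [φ]
  have : Module.Finite F K := h.1
  exact Algebra.IsIntegral.isIntegral (R := F) (A := K)

/-! ### The two implications -/

/-- The composite D ⟶ H is invariant under both groups, so the function field of H lies in the
invariants of Γ₁ ⊔ Γ₂. By the tower law the order of Γ₁ ⊔ Γ₂ divides the degree of D ⟶ H, which is d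
* |Γ₁|. -/
theorem DiagramCompletes.card_sup_le {D B C : Over SpecC} [IsIntegral D.left] [IsSeparated D.hom]
    {Γ₁ Γ₂ : Subgroup (Aut D)} [Finite Γ₁] [Finite ↥(Γ₁ ⊔ Γ₂)] {p : D ⟶ B} {q : D ⟶ C}
    (hp : IsQuotientByGroup Γ₁ p) (hq : IsQuotientByGroup Γ₂ q) {d e : ℕ} (hd : d ≠ 0)
    (h : DiagramCompletes p q d e) : Nat.card ↥(Γ₁ ⊔ Γ₂) ≤ d * Nat.card Γ₁ := by
  obtain ⟨H, u, v, -, hu, -, huv⟩ := h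
  obtain ⟨_, _, _, -⟩ := id hu
  have := hp.surjective_left
  have hu' := (hasDegree_iff u.left d).mp hu
  have : IsDominant (p ≫ u).left := by rw [Over.comp_left]; infer_instance
  have hw := comp_eq_of_mem_sup (p ≫ u)
    (fun γ hγ ↦ by rw [← Category.assoc, hp.invariant γ hγ])
    (fun γ hγ ↦ by rw [huv, ← Category.assoc, hq.invariant γ hγ])
  obtain ⟨l, hl⟩ := (invariantSubfield (Γ₁ ⊔ Γ₂)).subtype.exists_comp_eq Subtype.val_injective
    (functionFieldMap (p ≫ u).left).hom
    fun c ↦ ⟨⟨_, functionFieldMap_mem_invariantSubfield (p ≫ u) hw c⟩, rfl⟩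
  have h1 := hu'.comp hp.finiteOfDegree
  rw [← CommRingCat.hom_comp, ← functionFieldMap_comp] at h1
  exact Nat.le_of_dvd (Nat.mul_pos (Nat.pos_of_ne_zero hd) Nat.card_pos)
    (RingHom.FiniteOfDegree.dvd_of_comp (hl.symm ▸ h1) (finiteOfDegree_invariantSubfield _))

theorem preimage_comp_functionFieldMap {X Y : Over SpecC} [IsIntegral X.left] [IsIntegral Y.left]
    (f : X ⟶ Y) [IsDominant f.left] :
    Spec.preimage (fromSpecFunctionField Y.left ≫ Y.hom) ≫ functionFieldMap f.left =
      Spec.preimage (fromSpecFunctionField X.left ≫ X.hom) := by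
  apply Spec.map_injective
  rw [Spec.map_comp, Spec.map_preimage, Spec.map_preimage, specMap_functionFieldMap_assoc, Over.w]

/-- The inclusion of the field of invariants, as a morphism of rings. -/
noncomputable def invariantSubfieldι {S : Scheme.{0}} {X : Over S} [IsIntegral X.left]
    (Γ : Subgroup (Aut X)) : CommRingCat.of (invariantSubfield Γ) ⟶ X.left.functionField :=
  CommRingCat.ofHom (invariantSubfield Γ).subtype

/-- The quotient morphism by `Γ₁ ≤ Γ` can be followed by a morphism to any proper model of the field
of `Γ`-invariants. -/
theorem IsQuotientByGroup.exists_hasDegree {D B H : Over SpecC} [IsIntegral D.left]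
    [IsSeparated D.hom] [IsIntegral H.left] [IsProper H.hom]
    (hval : ∀ x, ValuationRing (D.left.presheaf.stalk x)) {Γ₁ Γ : Subgroup (Aut D)} [Finite Γ₁]
    [Finite Γ] (hΓ : Γ₁ ≤ Γ) {π : D ⟶ B} (hπ : IsQuotientByGroup Γ₁ π)
    (ι : H.left.functionField ⟶ .of (invariantSubfield Γ)) (hι : Function.Bijective ι.hom)
    (hH : Spec.map (invariantSubfieldι Γ) ≫ Spec.map ι ≫
      fromSpecFunctionField H.left ≫ H.hom = fromSpecFunctionField D.left ≫ D.hom)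
    {m : ℕ} (hm : Nat.card Γ = m * Nat.card Γ₁) :
    ∃ u : B ⟶ H, HasDegree u.left m ∧ fromSpecFunctionField D.left ≫ (π ≫ u).left =
      Spec.map (invariantSubfieldι Γ) ≫ Spec.map ι ≫
        fromSpecFunctionField H.left := by
  have := hπ.isIntegral_left
  have := hπ.surjective_left
  -- As Γ₁ ≤ Γ, the Γ-invariants lie among the Γ₁-invariants, which form the function field of `B`.
  obtain ⟨l, hl⟩ := (functionFieldMap π.left).hom.exists_comp_eq (RingHom.injective _)
    (invariantSubfield Γ).subtype fun c ↦ (hπ.mem_range_functionFieldMap_iff _).mpr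
      fun γ hγ ↦ mem_invariantSubfield.mp c.2 γ (hΓ hγ)
  obtain ⟨l, hl⟩ : ∃ l : CommRingCat.of (invariantSubfield Γ) ⟶ B.left.functionField,
      l ≫ functionFieldMap π.left = invariantSubfieldι Γ :=
    ⟨CommRingCat.ofHom l, CommRingCat.hom_ext hl⟩
  have hepi : Mono (functionFieldMap π.left) :=
    ConcreteCategory.mono_of_injective _ (RingHom.injective (functionFieldMap π.left).hom)
  obtain ⟨u, hu, hug⟩ := exists_extension_of_isProper B.hom H.hom (hπ.valuationRing_stalk hval)
    (Spec.map (l) ≫ Spec.map ι ≫ fromSpecFunctionField H.left) (by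
      have h1 : Spec.preimage (fromSpecFunctionField H.left ≫ H.hom) ≫ ι ≫ l =
          Spec.preimage (fromSpecFunctionField B.left ≫ B.hom) := by
        rw [← cancel_mono (functionFieldMap π.left), preimage_comp_functionFieldMap π]
        apply Spec.map_injective
        simp only [Category.assoc, hl, Spec.map_comp, Spec.map_preimage, hH]
      rw [← Spec.map_preimage (fromSpecFunctionField B.left ≫ B.hom), ← h1, Spec.map_comp,
        Spec.map_comp, Spec.map_preimage]
      simp only [Category.assoc])
  have hdom : IsDominant (fromSpecFunctionField B.left ≫ u) := by
    have : Surjective (Spec.map (ι ≫ l)) :=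
      ⟨Function.surjective_to_subsingleton (α := PrimeSpectrum B.left.functionField)
        (β := PrimeSpectrum H.left.functionField) _⟩
    rw [hug, ← Spec.map_comp_assoc]
    infer_instance
  have : IsDominant u := .of_comp (fromSpecFunctionField B.left) u
  have huf : functionFieldMap u = ι ≫ l := by
    rw [functionFieldMap_eq_iff, hug, Spec.map_comp, Category.assoc]
  -- D has degree |Γ| = m * |Γ₁| over H and |Γ₁| over B; cancelling leaves m.
  have hdeg : (functionFieldMap u).hom.FiniteOfDegree m := by
    refine RingHom.FiniteOfDegree.of_comp (ψ := (functionFieldMap π.left).hom) ?_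
      hπ.finiteOfDegree Nat.card_pos.ne'
    rw [← hm, ← CommRingCat.hom_comp, huf, Category.assoc, hl]
    exact (RingHom.finiteOfDegree_comp_ringEquiv_iff _ (RingEquiv.ofBijective ι.hom hι) _).mpr
      (finiteOfDegree_invariantSubfield Γ)
  refine ⟨Over.homMk u hu, (hasDegree_iff u m).mpr hdeg, ?_⟩
  change fromSpecFunctionField D.left ≫ π.left ≫ u = _
  rw [← specMap_functionFieldMap_assoc, hug, ← Spec.map_comp_assoc,
    hl]

theorem diagramCompletes_of_card_sup {D B C : Over SpecC} (hD : IsComplexCurve D)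
    [Smooth D.hom] {Γ₁ Γ₂ : Subgroup (Aut D)} [Finite Γ₁] [Finite Γ₂] [Finite ↥(Γ₁ ⊔ Γ₂)]
    {p : D ⟶ B} {q : D ⟶ C} (hp : IsQuotientByGroup Γ₁ p) (hq : IsQuotientByGroup Γ₂ q)
    (h : Nat.card ↥(Γ₁ ⊔ Γ₂) = Nat.card Γ₁ * Nat.card Γ₂) :
    DiagramCompletes p q (Nat.card Γ₂) (Nat.card Γ₁) := by
  have := hD.integral
  have := hD.proper
  have hval := valuationRing_stalk_of_smooth D.hom hD.dim_eq_one.le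
  let _ := algebraFunctionField D.hom
  let L := invariantSubfield (Γ₁ ⊔ Γ₂)
  -- The constants are invariant because the automorphisms are over ℂ.
  let _ : Algebra ℂ L := ((algebraMap ℂ D.left.functionField).codRestrict L fun c ↦
    mem_invariantSubfield.mpr fun γ _ ↦ congr($(preimage_comp_functionFieldMap γ.hom) c)).toAlgebra
  have : IsScalarTower ℂ L D.left.functionField := .of_algebraMap_eq' rfl
  have : Algebra.EssFiniteType ℂ D.left.functionField := essFiniteType_functionField D.hom
  have : Module.Finite L D.left.functionField := (finiteOfDegree_invariantSubfield (Γ₁ ⊔ Γ₂)).1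
  obtain ⟨H, _, g, ι, _, hg, hgι, hι⟩ := exists_proper_model L
    (IntermediateField.fg_top_of_isAlgebraic ℂ L D.left.functionField)
  have hH : Spec.map (invariantSubfieldι (Γ₁ ⊔ Γ₂)) ≫ Spec.map ι ≫
      fromSpecFunctionField H.left ≫ H.hom = fromSpecFunctionField D.left ≫ D.hom := by
    rw [reassoc_of% hgι, hg, ← Spec.map_comp, ← specMap_algebraMap_functionField]
    rfl
  obtain ⟨u, hu, hpu⟩ := hp.exists_hasDegree hval le_sup_left ι hι hH (h.trans (mul_comm _ _))
  obtain ⟨v, hv, hqv⟩ := hq.exists_hasDegree hval le_sup_right ι hι hH h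
  have huv : p ≫ u = q ≫ v := Over.OverMorphism.ext
    (eq_of_fromSpecFunctionField_comp_eq _ _ H.hom (by simp) (hpu.trans hqv.symm))
  refine ⟨H, u, v, ⟨‹_›, ‹_›, ?_⟩, hu, hv, huv⟩
  obtain ⟨_, _, _, -⟩ := id hu
  have := hp.surjective_left
  -- D is proper over ℂ and H is separated, so D ⟶ H is proper; it is also integral on function
  -- fields, so H inherits dimension one from D.
  have hproper : IsProper ((p.left ≫ u.left) ≫ H.hom) := by simpa using hD.proper
  have : IsProper (p.left ≫ u.left) := .of_comp _ H.hom
  refine topologicalKrullDim_eq_one_of_isProper (p.left ≫ u.left) ?_ hD.dim_eq_one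
  rw [functionFieldMap_comp]
  exact (((hasDegree_iff u.left _).mp hu).comp hp.finiteOfDegree).isIntegral

theorem mainTheorem8 (D : Over SpecC) (hD : IsComplexCurve D) (hDsmooth : Smooth D.hom)
    {G : Type*} [Group G] [Finite G] (ρ : G →* Aut D) (hρ : Function.Injective ρ)
    (α β : G) (d e : ℕ) (hα : orderOf α = d) (hβ : orderOf β = e) (hd : 2 ≤ d) (he : 2 ≤ e)
    (B C : Over SpecC) (p : D ⟶ B) (q : D ⟶ C)
    (hp : IsQuotientByGroup ((Subgroup.zpowers β).map ρ) p)
    (hq : IsQuotientByGroup ((Subgroup.zpowers α).map ρ) q) :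
    (Nat.card (Subgroup.closure {α, β}) = e * d → DiagramCompletes p q d e) ∧
    (e * d < Nat.card (Subgroup.closure {α, β}) → ¬ DiagramCompletes p q d e) := by
  have := hD.integral
  have := hD.proper
  have hcard (S : Subgroup G) : Nat.card (S.map ρ) = Nat.card S :=
    (Nat.card_congr (S.equivMapOfInjective ρ hρ).toEquiv).symm
  have hfin (S : Subgroup G) : Finite (S.map ρ) :=
    .of_equiv S (S.equivMapOfInjective ρ hρ).toEquiv
  have hsup : (Subgroup.zpowers β).map ρ ⊔ (Subgroup.zpowers α).map ρ =
      (Subgroup.closure {α, β}).map ρ := by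
    rw [← Subgroup.map_sup, Set.pair_comm, Set.insert_eq, Subgroup.closure_union,
      Subgroup.zpowers_eq_closure, Subgroup.zpowers_eq_closure]
  have : Finite ↥((Subgroup.zpowers β).map ρ ⊔ (Subgroup.zpowers α).map ρ) := hsup ▸ hfin _
  have hcα : Nat.card ((Subgroup.zpowers α).map ρ) = d := by rw [hcard, Nat.card_zpowers, hα]
  have hcβ : Nat.card ((Subgroup.zpowers β).map ρ) = e := by rw [hcard, Nat.card_zpowers, hβ]
  have hcs : Nat.card ↥((Subgroup.zpowers β).map ρ ⊔ (Subgroup.zpowers α).map ρ) =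
      Nat.card (Subgroup.closure {α, β}) := by rw [hsup, hcard]
  refine ⟨fun h ↦ ?_, fun h hc ↦ ?_⟩
  · have := diagramCompletes_of_card_sup hD hp hq (by rw [hcs, hcα, hcβ, h])
    rwa [hcα, hcβ] at this
  · have := hc.card_sup_le hp hq (by omega)
    rw [hcs, hcβ, mul_comm] at this
    exact this.not_gt h
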